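/- Let $F$ be a free group and let $w\in F$ be a nontrivial element with $w\in[F,F]$. For $v$ in a free group $F'$ and a group $G$, a $v$-word in $G$ is the image of $v$ under a homomorphism $F'\to G$. For $g$ in the subgroup of $G$ generated by the $v$-words, let $\mathrm{l}(g|v)$ be the minimum number of $v$-words and inverses of $v$-words in $G$ whose product is $g$, and let $\mathrm{sl}(g|v)=\lim_{n\to\infty}\mathrm{l}(g^n|v)/n$. Let $\mathrm{scl}(g)=\mathrm{sl}(g|[x,y])$, where $[x,y]=xyx^{-1}y^{-1}$ in the free group on $x,y$. Then, with $G=F$, the limits defining $\mathrm{scl}(w)$ and $\mathrm{sl}(w|w)$ exist and $$\frac12\le\frac{\mathrm{scl}(w)}{\mathrm{scl}(w)+\frac12}\le\mathrm{sl}(w|w)\le 1 .$$ -/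

import Mathlib

open Filter Topology
open scoped commutatorElement

namespace StableWLength

/-- A `W`-word in a group `G`: the image of some `w ∈ W` under a homomorphism `F →* G`
(`F` is a free group in all uses). -/
def IsWWord {F : Type*} [Group F] (W : Set F) {G : Type*} [Group G] (g : G) : Prop :=
  ∃ w ∈ W, ∃ φ : F →* G, φ w = g

/-- The verbal subgroup `G_W`, generated by the `W`-words in `G`. -/
def verbalSubgroup {F : Type*} [Group F] (W : Set F) (G : Type*) [Group G] : Subgroup G :=
  Subgroup.closure {g : G | IsWWord W g}

/-- `g` is a product of exactly `n` factors, each a `W`-word in `G` or the inverse of one. -/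
def IsWProduct {F : Type*} [Group F] (W : Set F) {G : Type*} [Group G] (n : ℕ) (g : G) : Prop :=
  ∃ l : List G, l.length = n ∧ (∀ x ∈ l, IsWWord W x ∨ IsWWord W x⁻¹) ∧ l.prod = g

/-- Such expressions exist precisely for the elements of the verbal subgroup. -/
theorem exists_isWProduct_iff {F : Type*} [Group F] (W : Set F) {G : Type*} [Group G] (g : G) :
    (∃ n, IsWProduct W n g) ↔ g ∈ verbalSubgroup W G := by
  rw [verbalSubgroup, ← Subgroup.mem_toSubmonoid, Subgroup.closure_toSubmonoid]
  constructor
  · rintro ⟨n, l, -, hl, rfl⟩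
    exact Submonoid.list_prod_mem _ fun x hx => Submonoid.subset_closure (hl x hx)
  · intro hg
    obtain ⟨l, hl, rfl⟩ := Submonoid.exists_list_of_mem_closure hg
    exact ⟨l.length, l, rfl, hl, rfl⟩

/-- The `W`-length `l_G(g|W)`: the minimum number of `W`-words and their inverses in `G` whose
product is `g`. It is meaningful for `g ∈ G_W`, where the set below is nonempty (and the minimum
is attained). -/
noncomputable def wLength {F : Type*} [Group F] (W : Set F) {G : Type*} [Group G] (g : G) : ℕ :=
  sInf {n : ℕ | IsWProduct W n g}

/-- The stable `W`-length `sl_G(g|W) = lim l_G(g ^ n|W) / n`, for `g ∈ G_W`. -/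
noncomputable def stableWLength {F : Type*} [Group F] (W : Set F) {G : Type*} [Group G]
    (g : G) : ℝ :=
  limUnder atTop fun n : ℕ => (wLength W (g ^ n) : ℝ) / n

/-- The word `[x, y] = x y x⁻¹ y⁻¹` in the free group on `x` and `y`. -/
def commutatorWord : FreeGroup (Fin 2) := ⁅FreeGroup.of (0 : Fin 2), FreeGroup.of (1 : Fin 2)⁆

/-- Commutator length: `[x, y]`-length. -/
noncomputable def cl {G : Type*} [Group G] (g : G) : ℕ := wLength {commutatorWord} g

/-- Stable commutator length: stable `[x, y]`-length. -/
noncomputable def scl {G : Type*} [Group G] (g : G) : ℝ := stableWLength {commutatorWord} g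

end StableWLength

/-!
Since `(ab) ^ n` is a product of `⌊n / 2⌋` commutators and `a ^ n * b ^ n`, a product `g` of `k`
elements, each a `w`-word or the inverse of one, satisfies `scl g ≤ k * (scl w + 1 / 2)`. Applied to
the powers of `g = w`, this gives `scl w ≤ sl(w|w) * (scl w + 1 / 2)`.

To see that `scl w ≥ 1 / 2`, write the letters of a cyclically reduced conjugate of `w` on the edges
of a circle with `N` vertices. As no two consecutive edges carry inverse letters, each generator can
be realized by an orientation-preserving homeomorphism of the circle such that every letter of `w`
moves its edge one step back; thus the free group acts on the line, by homeomorphisms commuting with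
`t ↦ t + 1`, so that `w` has translation number `-1`. On the other hand, a commutator of two such
homeomorphisms moves every point by less than `2`, so a product of `n` commutators has translation
number at most `2 n` in absolute value.
-/

namespace StableWLength

section WProduct

variable {E F G H : Type*} [Group E] [Group F] [Group G] [Group H] {V : Set E} {W : Set F}

theorem IsWWord.map {g : G} (hg : IsWWord W g) (ψ : G →* H) : IsWWord W (ψ g) := by
  obtain ⟨w, hw, φ, rfl⟩ := hg
  exact ⟨w, hw, ψ.comp φ, rfl⟩

theorem isWWord_of_mem {w : F} (hw : w ∈ W) : IsWWord W w := ⟨w, hw, MonoidHom.id F, rfl⟩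

theorem isWProduct_zero_one : IsWProduct W 0 (1 : G) := ⟨[], by simp⟩

theorem isWProduct_one_of_isWWord {g : G} (hg : IsWWord W g ∨ IsWWord W g⁻¹) :
    IsWProduct W 1 g :=
  ⟨[g], by simpa using hg⟩

theorem IsWProduct.mul {m n : ℕ} {g h : G} (hg : IsWProduct W m g) (hh : IsWProduct W n h) :
    IsWProduct W (m + n) (g * h) := by
  obtain ⟨l, rfl, hl, rfl⟩ := hg
  obtain ⟨l', rfl, hl', rfl⟩ := hh
  exact ⟨l ++ l', by simp, List.forall_mem_append.2 ⟨hl, hl'⟩, by simp⟩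

theorem IsWProduct.induction {p : ℕ → G → Prop} (one : p 0 1)
    (mul : ∀ n x g, IsWWord W x ∨ IsWWord W x⁻¹ → p n g → p (n + 1) (x * g))
    {n : ℕ} {g : G} (hg : IsWProduct W n g) : p n g := by
  obtain ⟨l, rfl, hl, rfl⟩ := hg
  induction l with
  | nil => exact one
  | cons x l ih =>
    rw [List.forall_mem_cons] at hl
    simpa using mul _ _ _ hl.1 (ih hl.2)

theorem IsWProduct.map {n : ℕ} {g : G} (hg : IsWProduct W n g) (ψ : G →* H) :
    IsWProduct W n (ψ g) := by
  refine hg.induction (p := fun n g => IsWProduct W n (ψ g)) ?_ fun n x g hx ih => ?_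
  · simpa using isWProduct_zero_one
  · have hψx : IsWWord W (ψ x) ∨ IsWWord W (ψ x)⁻¹ :=
      hx.imp (·.map ψ) fun h => map_inv ψ x ▸ h.map ψ
    simpa [add_comm] using (isWProduct_one_of_isWWord hψx).mul ih

theorem IsWProduct.inv {n : ℕ} {g : G} (hg : IsWProduct W n g) : IsWProduct W n g⁻¹ := by
  refine hg.induction (p := fun n g => IsWProduct W n g⁻¹) ?_ fun n x g hx ih => ?_
  · simpa using isWProduct_zero_one
  · simpa using ih.mul (isWProduct_one_of_isWWord (g := x⁻¹) (by simpa using hx.symm))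

theorem IsWProduct.conj {n : ℕ} {g : G} (hg : IsWProduct W n g) (a : G) :
    IsWProduct W n (a * g * a⁻¹) :=
  hg.map (MulAut.conj a).toMonoidHom

theorem IsWProduct.pow_of_isWWord {w : F} {j n : ℕ} (hw : IsWProduct V j (w ^ n)) {x : G}
    (hx : IsWWord {w} x ∨ IsWWord {w} x⁻¹) : IsWProduct V j (x ^ n) := by
  rcases hx with ⟨_, rfl, φ, rfl⟩ | ⟨_, rfl, φ, hφ⟩
  · simpa using hw.map φ
  · simpa [hφ] using (hw.map φ).inv

theorem verbalSubgroup_le_verbalSubgroup (h : W ⊆ verbalSubgroup V F) :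
    verbalSubgroup W G ≤ verbalSubgroup V G := by
  refine (Subgroup.closure_le _).2 ?_
  rintro _ ⟨w, hw, φ, rfl⟩
  obtain ⟨n, hn⟩ := (exists_isWProduct_iff V w).2 (h hw)
  exact (exists_isWProduct_iff V (φ w)).1 ⟨n, hn.map φ⟩

theorem isWProduct_wLength {g : G} (hg : g ∈ verbalSubgroup W G) :
    IsWProduct W (wLength W g) g :=
  Nat.sInf_mem (s := {n | IsWProduct W n g}) ((exists_isWProduct_iff W g).2 hg)

theorem IsWProduct.wLength_le {n : ℕ} {g : G} (hg : IsWProduct W n g) : wLength W g ≤ n :=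
  Nat.sInf_le hg

end WProduct

section StableLength

variable {F G : Type*} [Group F] [Group G] {W : Set F} {g : G}

theorem subadditive_wLength_pow (hg : g ∈ verbalSubgroup W G) :
    Subadditive fun n : ℕ => (wLength W (g ^ n) : ℝ) := by
  intro m n
  have h := (isWProduct_wLength (pow_mem hg m)).mul (isWProduct_wLength (pow_mem hg n))
  rw [← pow_add] at h
  beta_reduce
  exact_mod_cast h.wLength_le

theorem bddBelow_wLength_pow_div :
    BddBelow (Set.range fun n : ℕ => (wLength W (g ^ n) : ℝ) / n) :=
  ⟨0, by rintro _ ⟨n, rfl⟩; positivity⟩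

theorem tendsto_stableWLength (hg : g ∈ verbalSubgroup W G) :
    Tendsto (fun n : ℕ => (wLength W (g ^ n) : ℝ) / n) atTop (𝓝 (stableWLength W g)) :=
  tendsto_nhds_limUnder ⟨_, (subadditive_wLength_pow hg).tendsto_lim bddBelow_wLength_pow_div⟩

theorem stableWLength_le_wLength (hg : g ∈ verbalSubgroup W G) :
    stableWLength W g ≤ wLength W g := by
  have hlim := (subadditive_wLength_pow hg).tendsto_lim bddBelow_wLength_pow_div
  rw [tendsto_nhds_unique (tendsto_stableWLength hg) hlim]
  simpa using (subadditive_wLength_pow hg).lim_le_div bddBelow_wLength_pow_div one_ne_zero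

theorem stableWLength_pow (hg : g ∈ verbalSubgroup W G) (k : ℕ) :
    stableWLength W (g ^ k) = k * stableWLength W g := by
  rcases k.eq_zero_or_pos with rfl | hk
  · refine tendsto_nhds_unique (tendsto_stableWLength (pow_mem hg 0)) ?_
    have h_one : wLength W (1 : G) = 0 := Nat.le_zero.1 isWProduct_zero_one.wLength_le
    simp [h_one]
  have hsub : Tendsto (fun n : ℕ => (wLength W (g ^ (k * n)) : ℝ) / (k * n : ℕ)) atTop
      (𝓝 (stableWLength W g)) :=
    (tendsto_stableWLength hg).comp (tendsto_id.const_mul_atTop' hk)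
  refine tendsto_nhds_unique (tendsto_stableWLength (pow_mem hg k)) ?_
  refine (hsub.const_mul (k : ℝ)).congr fun n => ?_
  have hk' : (k : ℝ) ≠ 0 := by positivity
  rw [pow_mul, Nat.cast_mul, ← mul_div_assoc, mul_div_mul_left _ _ hk']

end StableLength

section Commutator

variable {F G : Type*} [Group F] [Group G]

theorem isWWord_commutatorWord_iff {g : G} :
    IsWWord {commutatorWord} g ↔ ∃ a b : G, ⁅a, b⁆ = g := by
  constructor
  · rintro ⟨_, rfl, φ, rfl⟩
    exact ⟨_, _, (map_commutatorElement φ _ _).symm⟩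
  · rintro ⟨a, b, rfl⟩
    exact ⟨_, rfl, FreeGroup.lift ![a, b], by simp [commutatorWord, map_commutatorElement]⟩

theorem isWWord_commutatorWord_inv_iff {g : G} :
    IsWWord {commutatorWord} g⁻¹ ↔ IsWWord {commutatorWord} g := by
  simp only [isWWord_commutatorWord_iff, ← inv_eq_iff_eq_inv, commutatorElement_inv]
  exact exists_comm

theorem verbalSubgroup_commutatorWord : verbalSubgroup {commutatorWord} G = commutator G := by
  simp only [verbalSubgroup, isWWord_commutatorWord_iff, commutator_eq_closure, commutatorSet]

theorem isWProduct_mul_pow_mul_inv (a b : G) (n : ℕ) :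
    IsWProduct {commutatorWord} (n / 2) ((a * b) ^ n * (a ^ n * b ^ n)⁻¹) := by
  induction n using Nat.twoStepInduction with
  | zero => simpa using isWProduct_zero_one
  | one => simpa using isWProduct_zero_one
  | more n ih _ =>
    have hcomm : IsWProduct {commutatorWord} 1 ⁅b ^ n * (a * b), a * (b ^ n)⁻¹⁆ :=
      isWProduct_one_of_isWWord (.inl (isWWord_commutatorWord_iff.2 ⟨_, _, rfl⟩))
    have hstep : (a * b) ^ (n + 2) * (a ^ (n + 2) * b ^ (n + 2))⁻¹ =
        (a * b) ^ n * (a ^ n * b ^ n)⁻¹ *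
          (a ^ n * ⁅b ^ n * (a * b), a * (b ^ n)⁻¹⁆ * (a ^ n)⁻¹) := by
      rw [commutatorElement_def, pow_add (a * b), pow_two (a * b)]
      generalize (a * b) ^ n = c
      group
    rw [hstep, Nat.add_div_right n two_pos]
    exact ih.mul (hcomm.conj (a ^ n))

theorem IsWProduct.pow {w : F} {g : G} {j k n : ℕ} (hg : IsWProduct {w} k g)
    (hw : IsWProduct {commutatorWord} j (w ^ n)) :
    IsWProduct {commutatorWord} (k * (n / 2 + j)) (g ^ n) := by
  refine hg.induction (p := fun k g => IsWProduct {commutatorWord} (k * (n / 2 + j)) (g ^ n))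
    ?_ fun k x g hx ih => ?_
  · simpa using isWProduct_zero_one
  · have h := (isWProduct_mul_pow_mul_inv x g n).mul ((hw.pow_of_isWWord hx).mul ih)
    rwa [inv_mul_cancel_right, ← add_assoc, add_comm, ← Nat.succ_mul] at h

theorem IsWProduct.scl_le {w : F} {g : G} {k : ℕ} (hg : IsWProduct {w} k g)
    (hw : w ∈ commutator F) : scl g ≤ k * (scl w + 1 / 2) := by
  rw [← verbalSubgroup_commutatorWord] at hw
  have hg' : g ∈ verbalSubgroup {commutatorWord} G :=
    verbalSubgroup_le_verbalSubgroup (by simpa using hw) ((exists_isWProduct_iff _ _).1 ⟨k, hg⟩)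
  refine le_of_tendsto_of_tendsto (tendsto_stableWLength hg')
    (((tendsto_stableWLength hw).add_const (1 / 2)).const_mul (k : ℝ)) ?_
  filter_upwards [eventually_gt_atTop 0] with n hn
  have : (0 : ℝ) < n := Nat.cast_pos.2 hn
  have hcl : (cl (g ^ n) : ℝ) ≤ k * ((n / 2 : ℕ) + cl (w ^ n)) := by
    exact_mod_cast (hg.pow (isWProduct_wLength (pow_mem hw n))).wLength_le
  have hhalf : ((n / 2 : ℕ) : ℝ) ≤ n / 2 := Nat.cast_div_le
  calc (cl (g ^ n) : ℝ) / n ≤ k * (n / 2 + cl (w ^ n)) / n := by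
        grw [hcl, hhalf]
    _ = k * (cl (w ^ n) / n + 1 / 2) := by field_simp; ring

theorem scl_le_stableWLength_mul {w : F} {g : G} (hw : w ∈ commutator F)
    (hg : g ∈ verbalSubgroup {w} G) : scl g ≤ stableWLength {w} g * (scl w + 1 / 2) := by
  have hg' : g ∈ verbalSubgroup {commutatorWord} G :=
    verbalSubgroup_le_verbalSubgroup (by simpa [verbalSubgroup_commutatorWord]) hg
  refine ge_of_tendsto ((tendsto_stableWLength hg).mul_const (scl w + 1 / 2)) ?_
  filter_upwards [eventually_gt_atTop 0] with n hn
  have hn' : (0 : ℝ) < n := Nat.cast_pos.2 hn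
  rw [div_mul_eq_mul_div, le_div_iff₀' hn', scl, ← stableWLength_pow hg']
  exact (isWProduct_wLength (pow_mem hg n)).scl_le hw

end Commutator

section Translation

open CircleDeg1Lift

theorem dist_map_map_comm_lt (f g : CircleDeg1Lift) (t : ℝ) : dist (f (g t)) (g (f t)) < 2 := by
  have h_zero (f g : CircleDeg1Lift) : dist (f (g 0)) (g (f 0)) < 2 :=
    dist_map_zero_lt_of_semiconjBy (f := g) (g₁ := f * g) (g₂ := g * f) (mul_assoc g f g).symm
  let T := translate (Multiplicative.ofAdd t)
  simpa [T] using h_zero (↑T⁻¹ * f * ↑T) (↑T⁻¹ * g * ↑T)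

theorem dist_commutatorElement_map_self_lt (f g : CircleDeg1Liftˣ) (t : ℝ) :
    dist (⁅f, g⁆ t) t < 2 := by
  simpa [commutatorElement_def] using dist_map_map_comm_lt f g (f⁻¹ (g⁻¹ t))

theorem IsWProduct.dist_map_self_le {n : ℕ} {f : CircleDeg1Liftˣ}
    (hf : IsWProduct {commutatorWord} n f) (t : ℝ) : dist (f t) t ≤ 2 * n := by
  refine hf.induction (p := fun n f => dist (f t) t ≤ 2 * n) (by simp) fun n x g hx ih => ?_
  rw [isWWord_commutatorWord_inv_iff, or_self, isWWord_commutatorWord_iff] at hx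
  obtain ⟨a, b, rfl⟩ := hx
  calc dist (⁅a, b⁆ (g t)) t ≤ dist (⁅a, b⁆ (g t)) (g t) + dist (g t) t := dist_triangle _ _ _
    _ ≤ 2 + 2 * n := add_le_add (dist_commutatorElement_map_self_lt a b (g t)).le ih
    _ = 2 * (n + 1 : ℕ) := by push_cast; ring

theorem IsWProduct.abs_translationNumber_le {n : ℕ} {f : CircleDeg1Liftˣ}
    (hf : IsWProduct {commutatorWord} n f) : |translationNumber f| ≤ 2 * n := by
  have hdist : ∀ t, -(2 * n : ℝ) ≤ f t - t ∧ f t - t ≤ 2 * n := fun t =>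
    abs_le.1 (hf.dist_map_self_le t)
  refine abs_le.2 ⟨le_translationNumber_of_add_le _ fun t => ?_,
    translationNumber_le_of_le_add _ fun t => ?_⟩
  · linarith [(hdist t).1]
  · linarith [(hdist t).2]

theorem abs_translationNumber_le_two_mul_scl {G : Type*} [Group G] (ρ : G →* CircleDeg1Liftˣ)
    {g : G} (hg : g ∈ commutator G) : |translationNumber (ρ g)| ≤ 2 * scl g := by
  rw [← verbalSubgroup_commutatorWord] at hg
  refine ge_of_tendsto ((tendsto_stableWLength hg).const_mul 2) ?_
  filter_upwards [eventually_gt_atTop 0] with n hn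
  have hn' : (0 : ℝ) < n := Nat.cast_pos.2 hn
  have h := ((isWProduct_wLength (pow_mem hg n)).map ρ).abs_translationNumber_le
  rw [map_pow, Units.val_pow_eq_pow_val, translationNumber_pow, abs_mul, Nat.abs_cast] at h
  rwa [← mul_div_assoc, le_div_iff₀' hn']

end Translation

section Interpolation

/-- The function on `ℝ` that extends `f` and is affine on each interval `[k, k + 1]`. -/
noncomputable def interpolate (f : ℤ → ℝ) (t : ℝ) : ℝ :=
  AffineMap.lineMap (f ⌊t⌋) (f (⌊t⌋ + 1)) (Int.fract t)

variable {f : ℤ → ℝ}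

theorem interpolate_intCast (k : ℤ) : interpolate f k = f k := by
  simp [interpolate]

theorem interpolate_intCast_add {r : ℝ} (hr : r ∈ Set.Ico 0 1) (k : ℤ) :
    interpolate f (k + r) = AffineMap.lineMap (f k) (f (k + 1)) r := by
  simp [interpolate, Int.floor_eq_zero_iff.2 hr, Int.fract_eq_self.2 hr]

theorem interpolate_add_natCast {N : ℕ} {a : ℝ} (hf : ∀ k, f (k + N) = f k + a) (t : ℝ) :
    interpolate f (t + N) = interpolate f t + a := by
  simp only [interpolate, Int.floor_add_natCast, Int.fract_add_natCast, hf,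
    add_right_comm _ (N : ℤ), AffineMap.lineMap_apply_ring']
  ring

theorem interpolate_mem_Ico (hf : StrictMono f) (t : ℝ) :
    interpolate f t ∈ Set.Ico (f ⌊t⌋) (f (⌊t⌋ + 1)) := by
  have hlt : f ⌊t⌋ < f (⌊t⌋ + 1) := hf (lt_add_one _)
  exact ⟨(left_le_lineMap_iff_nonneg hlt).2 (Int.fract_nonneg t),
    (lineMap_lt_right_iff_lt_one hlt).2 (Int.fract_lt_one t)⟩

theorem strictMono_interpolate (hf : StrictMono f) : StrictMono (interpolate f) := by
  intro s t hst
  rcases (Int.floor_mono hst.le).eq_or_lt with h | h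
  · have hfract : Int.fract s < Int.fract t := by
      simpa only [Int.fract, h, sub_lt_sub_iff_right] using hst
    rw [interpolate, interpolate, h]
    exact (lineMap_lt_lineMap_iff_of_lt' (hf (lt_add_one _))).2 hfract
  · exact (interpolate_mem_Ico hf s).2.trans_le
      ((hf.monotone (Int.add_one_le_iff.2 h)).trans (interpolate_mem_Ico hf t).1)

theorem Ico_subset_range_interpolate (k : ℤ) :
    Set.Ico (f k) (f (k + 1)) ⊆ Set.range (interpolate f) := by
  rintro y ⟨hky, hyk⟩
  have hpos : 0 < f (k + 1) - f k := by linarith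
  have hr : (y - f k) / (f (k + 1) - f k) ∈ Set.Ico (0 : ℝ) 1 :=
    ⟨div_nonneg (by linarith) hpos.le, (div_lt_one hpos).2 (by linarith)⟩
  refine ⟨k + (y - f k) / (f (k + 1) - f k), ?_⟩
  rw [interpolate_intCast_add hr, AffineMap.lineMap_apply_ring', div_mul_cancel₀ _ hpos.ne',
    sub_add_cancel]

open AddConstMap in
theorem exists_mem_Ico_map_add_one {N : ℤ} (f : ℤ →+c[N, 1] ℝ) (hf : Monotone f) (y : ℝ) :
    ∃ k, y ∈ Set.Ico (f k) (f (k + 1)) := by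
  have hmul (n : ℤ) : f (n * N) = f 0 + n := by
    simpa using AddConstMapClass.map_zsmul_const f n
  have hle : f (⌊y - f 0⌋ * N) ≤ y := by
    rw [hmul]
    linarith [Int.floor_le (y - f 0)]
  have hlt : y < f ((⌊y - f 0⌋ + 1) * N) := by
    rw [hmul]
    push_cast
    linarith [Int.lt_floor_add_one (y - f 0)]
  obtain ⟨k, hky, hk⟩ := Int.exists_greatest_of_bdd (P := fun k => f k ≤ y)
    ⟨_, fun k hk => (hf.reflect_lt (hk.trans_lt hlt)).le⟩ ⟨_, hle⟩
  exact ⟨k, hky, not_le.1 fun h => (hk _ h).not_gt (lt_add_one k)⟩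

open AddConstMap in
theorem exists_circleDeg1Lift_extending {N : ℕ} (hN : N ≠ 0) (f : ℤ →+c[(N : ℤ), 1] ℝ)
    (hf : StrictMono f) : ∃ u : CircleDeg1Liftˣ, ∀ k : ℤ, u (k / N) = f k := by
  have hN' : (0 : ℝ) < N := by positivity
  have hmono : StrictMono fun t : ℝ => interpolate f (t * N) :=
    (strictMono_interpolate hf).comp (strictMono_mul_right_of_pos hN')
  let u : CircleDeg1Lift :=
    { toFun t := interpolate f (t * N)
      monotone' := hmono.monotone
      map_add_one' t := by
        rw [add_one_mul, interpolate_add_natCast (AddConstMapClass.map_add_const f)] }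
  have hsurj : Function.Surjective u := by
    intro y
    obtain ⟨k, hk⟩ := exists_mem_Ico_map_add_one f hf.monotone y
    obtain ⟨t, rfl⟩ := Ico_subset_range_interpolate k hk
    exact ⟨t / N, congrArg (interpolate f) (div_mul_cancel₀ t hN'.ne')⟩
  obtain ⟨v, hv⟩ := CircleDeg1Lift.isUnit_iff_bijective.2 ⟨hmono.injective, hsurj⟩
  refine ⟨v, fun k => ?_⟩
  rw [hv]
  exact (congrArg (interpolate f) (div_mul_cancel₀ _ hN'.ne')).trans (interpolate_intCast k)

end Interpolation

section PushDown

open scoped Classical in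
/-- A strictly increasing map on `ℤ` lowering the edges `[k, k + 1]`, `k ∈ D`: it sends the upper
endpoint of each of them to the lower one. The lower endpoint of a maximal run of such edges is
lowered by `1 / 2` to keep the map strictly increasing, and all other integers are fixed. -/
noncomputable def pushDown (D : Set ℤ) (k : ℤ) : ℝ :=
  if k - 1 ∈ D then k - 1 else if k ∈ D then k - 1 / 2 else k

theorem pushDown_add_one_of_mem {D : Set ℤ} {k : ℤ} (hk : k ∈ D) : pushDown D (k + 1) = k := by
  simp [pushDown, hk]

theorem pushDown_add_one_of_notMem {D : Set ℤ} {k : ℤ} (hk : k ∉ D) (hk' : k + 1 ∉ D) :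
    pushDown D (k + 1) = (k + 1 : ℤ) := by
  simp [pushDown, hk, hk']

theorem strictMono_pushDown (D : Set ℤ) : StrictMono (pushDown D) := by
  refine strictMono_int_of_lt_succ fun k => ?_
  by_cases h : k - 1 ∈ D <;> by_cases h' : k ∈ D <;> by_cases h'' : k + 1 ∈ D <;>
    simp [pushDown, h, h', h''] <;> linarith

theorem pushDown_add {D : Set ℤ} {N : ℤ} (hD : ∀ k, k + N ∈ D ↔ k ∈ D) (k : ℤ) :
    pushDown D (k + N) = pushDown D k + N := by
  have hD' : k + N - 1 ∈ D ↔ k - 1 ∈ D := by rw [add_sub_right_comm, hD]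
  by_cases h : k - 1 ∈ D <;> by_cases h' : k ∈ D <;> simp [pushDown, hD, hD', h, h'] <;> ring

theorem exists_circleDeg1Lift_pushDown {N : ℕ} (hN : N ≠ 0) {D : Set ℤ}
    (hD : ∀ k : ℤ, k + N ∈ D ↔ k ∈ D) :
    ∃ u : CircleDeg1Liftˣ, ∀ k : ℤ, u (k / N) = pushDown D k / N := by
  refine exists_circleDeg1Lift_extending hN ⟨fun k => pushDown D k / N, fun k => ?_⟩ ?_
  · field_simp
    simpa using pushDown_add hD k
  · exact (strictMono_pushDown D).div_const (by positivity)

end PushDown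

section CyclicWord

variable {α : Type*}

/-- The bi-infinite periodic sequence obtained by reading the nonempty list `l` cyclically. -/
def cyclicGet (l : List α) (hl : l ≠ []) (k : ℤ) : α :=
  l[(k % l.length).toNat]'(by
    have hpos : (0 : ℤ) < l.length := Int.natCast_pos.2 (List.length_pos_iff.2 hl)
    have := Int.emod_lt_of_pos k hpos
    omega)

variable {l : List α} {hl : l ≠ []}

theorem cyclicGet_natCast {i : ℕ} (hi : i < l.length) : cyclicGet l hl i = l[i] := by
  simp only [cyclicGet, ← Int.natCast_mod, Int.toNat_natCast, Nat.mod_eq_of_lt hi]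

theorem periodic_cyclicGet : Function.Periodic (cyclicGet l hl) l.length := fun k => by
  simp only [cyclicGet, Int.add_emod_right]

theorem rel_cyclicGet_add_one {R : α → α → Prop} (hR : l.IsChain R)
    (hR' : ∀ a ∈ l.getLast?, ∀ b ∈ l.head?, R a b) (k : ℤ) :
    R (cyclicGet l hl k) (cyclicGet l hl (k + 1)) := by
  have hpos : 0 < l.length := List.length_pos_iff.2 hl
  have hper : Function.Periodic (fun k => R (cyclicGet l hl k) (cyclicGet l hl (k + 1)))
      (l.length : ℤ) := fun k => by
    beta_reduce
    rw [add_right_comm, periodic_cyclicGet, periodic_cyclicGet]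
  obtain ⟨i, ⟨hi, hil⟩, h⟩ := hper.exists_mem_Ico₀ (Int.natCast_pos.2 hpos) k
  refine h.mpr ?_
  lift i to ℕ using hi
  replace hil : i + 1 ≤ l.length := by exact_mod_cast hil
  rw [cyclicGet_natCast hil]
  rcases hil.lt_or_eq with hlt | heq
  · rw [← Nat.cast_succ, cyclicGet_natCast hlt]
    exact List.isChain_iff_getElem.1 hR i hlt
  · have hwrap : cyclicGet l hl (i + 1) = l[0] :=
      calc cyclicGet l hl (i + 1) = cyclicGet l hl (0 + l.length) := by simp [← heq]
        _ = cyclicGet l hl (0 : ℕ) := periodic_cyclicGet 0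
        _ = l[0] := cyclicGet_natCast hpos
    rw [hwrap]
    exact hR' _ (by simp [List.getLast?_eq_getElem?, ← heq]) _ (by simp [List.head?_eq_getElem?])

end CyclicWord

section Action

open CircleDeg1Lift

variable {α : Type*}

theorem exists_hom_mk_singleton_apply {N : ℕ} (hN : N ≠ 0) {c : ℤ → α × Bool}
    (hc : Function.Periodic c N) (hred : ∀ k, (c k).1 = (c (k + 1)).1 → (c k).2 = (c (k + 1)).2) :
    ∃ ρ : FreeGroup α →* CircleDeg1Liftˣ,
      ∀ k : ℤ, ρ (FreeGroup.mk [c k]) ((k + 1 : ℤ) / N) = k / N := by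
  choose u hu using fun a => exists_circleDeg1Lift_pushDown hN (D := c ⁻¹' {a})
    fun k => by rw [Set.mem_preimage, Set.mem_preimage, hc k]
  -- `u a` pushes the edges labelled `a` down; no letter `a` is next to a letter `a⁻¹`, so `u a⁻¹`
  -- fixes the endpoints of these edges.
  let ρ := FreeGroup.lift fun x => u (x, true) * (u (x, false))⁻¹
  have hρ (a : α × Bool) : ρ (FreeGroup.mk [a]) = u a * (u (a.1, !a.2))⁻¹ := by
    rcases a with ⟨x, _ | _⟩ <;> simp [ρ]
  refine ⟨ρ, fun k => ?_⟩
  have hfix : u ((c k).1, !(c k).2) ((k + 1 : ℤ) / N) = (k + 1 : ℤ) / N := by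
    rw [hu, pushDown_add_one_of_notMem]
    · simp [Prod.ext_iff]
    · have := hred k
      grind
  have hmove : u (c k) ((k + 1 : ℤ) / N) = k / N := by
    rw [hu, pushDown_add_one_of_mem (by simp)]
  have hfix' := units_inv_apply_apply (u ((c k).1, !(c k).2)) ((k + 1 : ℤ) / N)
  rw [hfix] at hfix'
  rw [hρ, Units.val_mul, mul_apply, hfix', hmove]

theorem hom_mk_apply_length (ρ : FreeGroup α →* CircleDeg1Liftˣ) {l : List (α × Bool)} {p : ℕ → ℝ}
    (h : ∀ i (hi : i < l.length), ρ (FreeGroup.mk [l[i]]) (p (i + 1)) = p i) :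
    ρ (FreeGroup.mk l) (p l.length) = p 0 := by
  induction l generalizing p with
  | nil => simp [← FreeGroup.one_eq_mk]
  | cons a l ih =>
    have htail : ρ (FreeGroup.mk l) (p (l.length + 1)) = p 1 :=
      ih (p := fun i => p (i + 1)) fun i hi => h (i + 1) (Nat.succ_lt_succ hi)
    rw [← List.singleton_append, ← FreeGroup.mul_mk, map_mul, Units.val_mul, mul_apply,
      List.singleton_append, List.length_cons, htail]
    exact h 0 (Nat.succ_pos _)

theorem exists_translationNumber_mk_eq_neg_one {l : List (α × Bool)} (hl : l ≠ [])
    (hred : FreeGroup.IsCyclicallyReduced l) :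
    ∃ ρ : FreeGroup α →* CircleDeg1Liftˣ, translationNumber (ρ (FreeGroup.mk l)) = -1 := by
  have hN : l.length ≠ 0 := List.length_eq_zero_iff.not.2 hl
  obtain ⟨ρ, hρ⟩ := exists_hom_mk_singleton_apply hN (periodic_cyclicGet (hl := hl))
    (rel_cyclicGet_add_one hred.1 hred.2)
  refine ⟨ρ, ?_⟩
  have h : ρ (FreeGroup.mk l) ((l.length : ℝ) / l.length) = (0 : ℕ) / l.length :=
    hom_mk_apply_length ρ (p := fun i => i / l.length) fun i hi => by
      simpa [cyclicGet_natCast hi] using hρ i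
  rw [div_self (Nat.cast_ne_zero.2 hN), Nat.cast_zero, zero_div] at h
  simpa using translationNumber_of_eq_add_int (ρ (FreeGroup.mk l) : CircleDeg1Lift)
    (x := 1) (m := -1) (by simp [h])

theorem exists_isCyclicallyReduced_isConj {v : FreeGroup α} (hv : v ≠ 1) :
    ∃ l, l ≠ [] ∧ FreeGroup.IsCyclicallyReduced l ∧ IsConj (FreeGroup.mk l) v := by
  classical
  have hconj : IsConj (FreeGroup.mk (FreeGroup.reduceCyclically v.toWord)) v := by
    refine isConj_iff.2 ⟨FreeGroup.mk (FreeGroup.reduceCyclically.conjugator v.toWord), ?_⟩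
    rw [FreeGroup.inv_mk, FreeGroup.mul_mk, FreeGroup.mul_mk,
      FreeGroup.reduceCyclically.conj_conjugator_reduceCyclically, FreeGroup.mk_toWord]
  refine ⟨_, fun h => hv ?_,
    FreeGroup.reduceCyclically.isCyclicallyReduced FreeGroup.isReduced_toWord, hconj⟩
  rwa [h, ← FreeGroup.one_eq_mk, isConj_one_right] at hconj

theorem translationNumber_eq_of_isConj {f g : CircleDeg1Liftˣ} (h : IsConj f g) :
    translationNumber f = translationNumber g := by
  obtain ⟨a, rfl⟩ := isConj_iff.1 h
  simp

variable {F : Type*} [Group F] [IsFreeGroup F] {w : F}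

theorem exists_translationNumber_eq_neg_one (hw : w ≠ 1) :
    ∃ ρ : F →* CircleDeg1Liftˣ, translationNumber (ρ w) = -1 := by
  let φ := (IsFreeGroup.toFreeGroup F).toMonoidHom
  have hφw : φ w ≠ 1 := by simpa [φ] using hw
  obtain ⟨l, hl, hred, hconj⟩ := exists_isCyclicallyReduced_isConj hφw
  obtain ⟨ρ, hρ⟩ := exists_translationNumber_mk_eq_neg_one hl hred
  exact ⟨ρ.comp φ, (translationNumber_eq_of_isConj (ρ.map_isConj hconj)).symm.trans hρ⟩

theorem half_le_scl (hw : w ≠ 1) (hwF : w ∈ commutator F) : 1 / 2 ≤ scl w := by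
  obtain ⟨ρ, hρ⟩ := exists_translationNumber_eq_neg_one hw
  have h := abs_translationNumber_le_two_mul_scl ρ hwF
  rw [hρ, abs_neg, abs_one] at h
  linarith

end Action

end StableWLength

theorem corollary2p17 {F : Type*} [Group F] [IsFreeGroup F] (w : F) (hw : w ≠ 1)
    (hwF : w ∈ commutator F) :
    Tendsto (fun n : ℕ => (StableWLength.cl (w ^ n) : ℝ) / n) atTop
        (𝓝 (StableWLength.scl w)) ∧
      Tendsto (fun n : ℕ => (StableWLength.wLength {w} (w ^ n) : ℝ) / n) atTop
        (𝓝 (StableWLength.stableWLength {w} w)) ∧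
      1 / 2 ≤ StableWLength.scl w / (StableWLength.scl w + 1 / 2) ∧
      StableWLength.scl w / (StableWLength.scl w + 1 / 2) ≤
        StableWLength.stableWLength {w} w ∧
      StableWLength.stableWLength {w} w ≤ 1 := by
  have hww : StableWLength.IsWWord {w} w := StableWLength.isWWord_of_mem rfl
  have hwV : w ∈ StableWLength.verbalSubgroup {w} F := Subgroup.subset_closure hww
  have hwC : w ∈ StableWLength.verbalSubgroup {StableWLength.commutatorWord} F :=
    StableWLength.verbalSubgroup_commutatorWord (G := F) ▸ hwF
  have hscl : 1 / 2 ≤ StableWLength.scl w := StableWLength.half_le_scl hw hwF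
  have hlen : (StableWLength.wLength {w} w : ℝ) ≤ 1 :=
    mod_cast (StableWLength.isWProduct_one_of_isWWord (.inl hww)).wLength_le
  refine ⟨StableWLength.tendsto_stableWLength hwC,
    StableWLength.tendsto_stableWLength hwV, ?_, ?_,
    (StableWLength.stableWLength_le_wLength hwV).trans hlen⟩
  · rw [le_div_iff₀ (by linarith)]
    linarith
  · rw [div_le_iff₀ (by linarith)]
    exact StableWLength.scl_le_stableWLength_mul hwF hwV
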